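/- Let $(\mathcal N,G)$ be a smooth Riemannian manifold without boundary, of finite dimension or modelled on a Hilbert space, with norm $\|v\|:=\sqrt{G(v,v)}$ on the tangent spaces and Levi-Civita connection $\nabla$. Let $U\subset\mathcal N$ be open and convex, in the sense that any two points of $U$ are joined by a geodesic that stays in $U$, and let $f:U\to\mathbb R$ be twice differentiable, with Riemannian gradient $\operatorname{grad} f$ and Riemannian Hessian $\operatorname{Hess} f(x)[h]:=\nabla_h\operatorname{grad} f$, $h\in T_x\mathcal N$. Let $\hat x\in U$. (a) If $\hat x$ is an optimal solution, i.e. a (local or global) minimizer of $f$ on $U$, then $G(\operatorname{Hess} f(\hat x)h,h)\ge 0$ for all $h\in T_{\hat x}\mathcal N$. (b) Suppose that $\operatorname{grad} f(\hat x)=0$; that $\operatorname{Hess} f(\hat x)$ is coercive, i.e. there is $c>0$ with $G(\operatorname{Hess} f(\hat x)h,h)\ge c\|h\|^2$ for all $h\in T_{\hat x}\mathcal N$; and that the Hessian satisfies the following Lipschitz condition at $\hat x$: there is a constant $L<\infty$ such that $$\|\mathcal P_{1,0}\operatorname{Hess} f(\exp_{\hat x}(\Delta x))\,\mathcal P_{0,1}-\operatorname{Hess}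 f(\hat x)\|\le L\|\Delta x\|$$ for all $\Delta x\in T_{\hat x}\mathcal N$ in the domain of $\exp_{\hat x}$ for which the geodesic $\gamma(t)=\exp_{\hat x}(t\Delta x)$, $t\in[0,1]$, stays in $U$, where $\mathcal P_{\alpha,\beta}:T_{\gamma(\alpha)}\mathcal N\to T_{\gamma(\beta)}\mathcal N$ is the parallel transport along $\gamma$ and the norm on the left is the operator norm. Then $\hat x$ is a local minimum of $f$ on $U$. -/

import Mathlib

noncomputable section

namespace RiemannianOpt

section

variable {E : Type*} [NormedAddCommGroup E] [NormedSpace ℝ E]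

/-- For a field `g` of bilinear forms on `E`, with `∂_a g` its derivative at `u` in direction `a`:
`koszulForm g u w v z = ½ (∂_v g(w, z) + ∂_w g(v, z) - ∂_z g(w, v))`. -/
def koszulForm (g : E → E →L[ℝ] E →L[ℝ] ℝ) (u w : E) : E →L[ℝ] E →L[ℝ] ℝ :=
  let D : E →L[ℝ] E →L[ℝ] E →L[ℝ] ℝ := fderiv ℝ g u
  (1 / 2 : ℝ) • (D.flip w + D w - (D.flip w).flip)

theorem koszulForm_apply (g : E → E →L[ℝ] E →L[ℝ] ℝ) (u w v z : E) :
    koszulForm g u w v z =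
      1 / 2 * (fderiv ℝ g u v w z + fderiv ℝ g u w v z - fderiv ℝ g u z w v) := rfl

end

end RiemannianOpt

end

open Set Bundle Manifold
open scoped ContDiff Topology

noncomputable section

/-! Throughout, `N` is a smooth manifold without boundary modelled on a Banach space `E` (of finite
or infinite dimension). A Riemannian metric on `N` is Mathlib's `RiemannianBundle` structure on the
tangent bundle: an inner product `inner ℝ v w` on every tangent space, with norm
`‖v‖ = √(inner ℝ v v)`, inducing the topology of the tangent space. -/

namespace RiemannianOpt

section

variable {E : Type*} [NormedAddCommGroup E] [NormedSpace ℝ E]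
  {N : Type*} [TopologicalSpace N] [ChartedSpace E N] [IsManifold 𝓘(ℝ, E) ∞ N]

/-- Coordinates of tangent vectors at `y` in the preferred chart around `p`. For `y` in the domain
of this chart it is the derivative of the chart at `y`, and for `y = p` it is the identity. -/
def coord (p y : N) : TangentSpace 𝓘(ℝ, E) y →L[ℝ] E :=
  (trivializationAt E (TangentSpace 𝓘(ℝ, E)) p).continuousLinearMapAt ℝ y

/-- The inverse of `coord p y`, for `y` in the domain of the preferred chart around `p`. -/
def coordInv (p y : N) : E →L[ℝ] TangentSpace 𝓘(ℝ, E) y :=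
  (trivializationAt E (TangentSpace 𝓘(ℝ, E)) p).symmL ℝ y

variable [RiemannianBundle (fun x : N ↦ TangentSpace 𝓘(ℝ, E) x)]

/-- A tangent space of a Riemannian manifold is complete, i.e. a Hilbert space. -/
theorem completeSpace_tangentSpace [CompleteSpace E] (x : N) :
    CompleteSpace (TangentSpace 𝓘(ℝ, E) x) := by
  let e : TangentSpace 𝓘(ℝ, E) x ≃L[ℝ] E :=
    (trivializationAt E (TangentSpace 𝓘(ℝ, E)) x).continuousLinearEquivAt ℝ x
      (FiberBundle.mem_baseSet_trivializationAt' x)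
  exact (completeSpace_congr (e := e.toEquiv) e.isUniformEmbedding).2 inferInstance

/-- The metric in the preferred chart around `p`: the Gram form `(v, w) ↦ g_u(v, w)` at the
coordinate point `u`. -/
def metricInChart (p : N) (u : E) : E →L[ℝ] E →L[ℝ] ℝ :=
  let y : N := (chartAt E p).symm u
  let g : TangentSpace 𝓘(ℝ, E) y →L[ℝ] TangentSpace 𝓘(ℝ, E) y →L[ℝ] ℝ := innerSL ℝ
  g.bilinearComp (coordInv p y) (coordInv p y)

variable [CompleteSpace E]

/-- The Riesz representative: `riesz x ℓ` is the vector `v` with `⟪v, w⟫ = ℓ w` for all `w`. -/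
def riesz (x : N) (l : TangentSpace 𝓘(ℝ, E) x →L[ℝ] ℝ) : TangentSpace 𝓘(ℝ, E) x :=
  haveI := completeSpace_tangentSpace (E := E) x
  (InnerProductSpace.toDual ℝ (TangentSpace 𝓘(ℝ, E) x)).symm l

/-- The Christoffel symbol `v ↦ Γ(v, w)` of the Levi-Civita connection at `p` in the preferred chart
around `p`, determined by `⟪Γ(v, w), z⟫ = ½ (∂_v g(w, z) + ∂_w g(v, z) - ∂_z g(v, w))`. -/
def christoffel (p : N) (w : TangentSpace 𝓘(ℝ, E) p) :
    TangentSpace 𝓘(ℝ, E) p →L[ℝ] TangentSpace 𝓘(ℝ, E) p :=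
  haveI := completeSpace_tangentSpace (E := E) p
  let B : TangentSpace 𝓘(ℝ, E) p →L[ℝ] TangentSpace 𝓘(ℝ, E) p →L[ℝ] ℝ :=
    koszulForm (E := E) (metricInChart p) (chartAt E p p) w
  InnerProductSpace.continuousLinearMapOfBilin B

/-- The Levi-Civita covariant derivative `v ↦ ∇_v Y` at `x` of a vector field `Y`: in coordinates
`∇_v Y = DY v + Γ(v, Y)`. -/
def covDeriv (Y : ∀ x : N, TangentSpace 𝓘(ℝ, E) x) (x : N) :
    TangentSpace 𝓘(ℝ, E) x →L[ℝ] TangentSpace 𝓘(ℝ, E) x :=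
  let D : TangentSpace 𝓘(ℝ, E) x →L[ℝ] E := mvfderiv 𝓘(ℝ, E) (fun y ↦ coord x y (Y y)) x
  (coordInv x x).comp D + christoffel x (Y x)

/-- The Riemannian gradient: `⟪grad f x, w⟫ = df(x) w`. -/
def grad (f : N → ℝ) (x : N) : TangentSpace 𝓘(ℝ, E) x :=
  riesz x (mvfderiv 𝓘(ℝ, E) f x)

/-- The Riemannian Hessian `Hess f(x)[h] = ∇_h grad f`, a linear map of the tangent space at `x`. -/
def hess (f : N → ℝ) (x : N) : TangentSpace 𝓘(ℝ, E) x →L[ℝ] TangentSpace 𝓘(ℝ, E) x :=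
  covDeriv (grad f) x

/-- `f` is twice differentiable on `U`: it is differentiable at every point of `U`, and so is its
gradient field. -/
def TwiceDifferentiableOn (f : N → ℝ) (U : Set N) : Prop :=
  ∀ x ∈ U, MDifferentiableAt 𝓘(ℝ, E) 𝓘(ℝ, ℝ) f x ∧
    MDifferentiableAt 𝓘(ℝ, E) (𝓘(ℝ, E).prod 𝓘(ℝ, E))
      (fun y ↦ (⟨y, grad f y⟩ : TangentBundle 𝓘(ℝ, E) N)) x

/-- The velocity of a curve parametrized by `[0, 1]`. -/
def velocity (γ : ℝ → N) (t : ℝ) : TangentSpace 𝓘(ℝ, E) (γ t) :=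
  mfderivWithin 𝓘(ℝ, ℝ) 𝓘(ℝ, E) γ (Icc 0 1) t (1 : ℝ)

/-- The covariant derivative at time `t` of a vector field `V` along a curve `γ : [0, 1] → N`:
in coordinates `V' + Γ(γ', V)`. -/
def covDerivAlong (γ : ℝ → N) (V : ∀ t, TangentSpace 𝓘(ℝ, E) (γ t)) (t : ℝ) :
    TangentSpace 𝓘(ℝ, E) (γ t) :=
  coordInv (γ t) (γ t) (derivWithin (fun s ↦ coord (E := E) (γ t) (γ s) (V s)) (Icc 0 1) t) +
    christoffel (γ t) (V t) (velocity γ t)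

variable (E) in
/-- `γ : [0, 1] → N` is a geodesic (affinely parametrized). -/
def IsGeodesic (γ : ℝ → N) : Prop :=
  ContMDiffOn 𝓘(ℝ, ℝ) 𝓘(ℝ, E) 2 γ (Icc 0 1) ∧
    ∀ t ∈ Icc (0 : ℝ) 1, covDerivAlong (E := E) γ (velocity γ) t = 0

/-- `V` is a parallel vector field along `γ : [0, 1] → N`. -/
def IsParallel (γ : ℝ → N) (V : ∀ t, TangentSpace 𝓘(ℝ, E) (γ t)) : Prop :=
  ContMDiffOn 𝓘(ℝ, ℝ) (𝓘(ℝ, E).prod 𝓘(ℝ, E)) 1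
      (fun t ↦ (⟨γ t, V t⟩ : TangentBundle 𝓘(ℝ, E) N)) (Icc 0 1) ∧
    ∀ t ∈ Icc (0 : ℝ) 1, covDerivAlong γ V t = 0

open Classical in
/-- Parallel transport along `γ` from time `a` to time `b`, with `a, b ∈ [0, 1]`. -/
def parallelTransport (γ : ℝ → N) (a b : ℝ) (v : TangentSpace 𝓘(ℝ, E) (γ a)) :
    TangentSpace 𝓘(ℝ, E) (γ b) :=
  if h : ∃ V : ∀ t, TangentSpace 𝓘(ℝ, E) (γ t), IsParallel γ V ∧ V a = v then h.choose b else 0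

/-- The curve `γ : [0, 1] → N` is a geodesic with `γ 0 = x` and initial velocity `v`. -/
def IsGeodesicFrom (x : N) (v : TangentSpace 𝓘(ℝ, E) x) (γ : ℝ → N) : Prop :=
  IsGeodesic E γ ∧
    (⟨γ 0, velocity γ 0⟩ : TangentBundle 𝓘(ℝ, E) N) = ⟨x, v⟩

/-- The domain of the exponential map at `x`. -/
def expDomain (x : N) : Set (TangentSpace 𝓘(ℝ, E) x) :=
  {v | ∃ γ : ℝ → N, IsGeodesicFrom x v γ}

open Classical in
/-- The exponential map at `x` (with the value `x` outside of its domain). -/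
def expMap (x : N) (v : TangentSpace 𝓘(ℝ, E) x) : N :=
  if h : ∃ γ : ℝ → N, IsGeodesicFrom x v γ then h.choose 1 else x

variable (E) in
/-- Any two points of `U` are joined by a geodesic that stays in `U`. -/
def GeodesicallyConvex (U : Set N) : Prop :=
  ∀ x ∈ U, ∀ y ∈ U, ∃ v ∈ expDomain (E := E) x, expMap x v = y ∧
    ∀ t ∈ Icc (0 : ℝ) 1, expMap x (t • v) ∈ U

/-- The Lipschitz condition with constant `L` at `x` for the Hessian of `f` on `U`: for every
geodesic `γ(t) = exp_x(t Δx)`, `0 ≤ t ≤ 1`, in `U`, the operator norm satisfies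
`‖P_{1,0} Hess f(exp_x(Δx)) P_{0,1} - Hess f(x)‖ ≤ L ‖Δx‖`. Here `γ 0 = x`. -/
def HessLipschitzAt (f : N → ℝ) (U : Set N) (L : ℝ) (x : N) : Prop :=
  ∀ Δx ∈ expDomain (E := E) x,
    let γ : ℝ → N := fun t ↦ expMap x (t • Δx)
    (∀ t ∈ Icc (0 : ℝ) 1, γ t ∈ U) →
      ∀ h : TangentSpace 𝓘(ℝ, E) (γ 0),
        ‖parallelTransport γ 1 0 (hess f (γ 1) (parallelTransport γ 0 1 h)) - hess f (γ 0) h‖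
          ≤ L * ‖Δx‖ * ‖h‖

end

end RiemannianOpt

end

/-! In the preferred chart around a critical point `p` of `f`, the derivative of `f` is
`u ↦ g_u(Y u, ·)`, with `g` the Gram form and `Y` the coordinates of the gradient. As `Y` vanishes
at `p`, the second derivative there is `g_p(DY ·, ·)`: the derivative of `g` does not enter. Neither
does the Christoffel symbol enter the Hessian, so the Hessian is the second derivative of `f` in the
chart, and both claims reduce to the second order conditions in a normed space. -/

namespace RiemannianOpt

open ContinuousLinearMap Filter

section NormedSpace

variable {V W : Type*} [NormedAddCommGroup V] [NormedSpace ℝ V]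
  [NormedAddCommGroup W] [NormedSpace ℝ W]

theorem deriv_deriv_nonneg_of_isLocalMin {φ : ℝ → ℝ} {t : ℝ} (hφ : ContinuousAt φ t)
    (hmin : IsLocalMin φ t) : 0 ≤ deriv (deriv φ) t := by
  by_contra! hneg
  -- By the second derivative test `t` is also a local maximum, so `φ` is constant near `t`.
  have hmax : IsLocalMax φ t := isLocalMax_of_deriv_deriv_neg hneg hmin.deriv_eq_zero hφ
  have hconst : φ =ᶠ[𝓝 t] fun _ ↦ φ t := by
    filter_upwards [hmin, hmax] with s hs hs' using le_antisymm hs' hs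
  have hzero : deriv (deriv φ) t = 0 := by simpa using hconst.deriv.deriv_eq
  exact hneg.ne hzero

theorem fderiv_fderiv_apply_self_nonneg_of_isLocalMin {F : V → ℝ} {x : V}
    (hF : ∀ᶠ u in 𝓝 x, DifferentiableAt ℝ F u) (hF' : DifferentiableAt ℝ (fderiv ℝ F) x)
    (hmin : IsLocalMin F x) (v : V) : 0 ≤ fderiv ℝ (fderiv ℝ F) x v v := by
  let ℓ : ℝ → V := fun t ↦ x + t • v
  have hℓ (t : ℝ) : HasDerivAt ℓ v t := by
    simpa [ℓ] using (hasDerivAt_id t).smul_const v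
  have hℓ0 : ℓ 0 = x := by simp [ℓ]
  have hlim : Tendsto ℓ (𝓝 0) (𝓝 x) := by simpa only [hℓ0] using (hℓ 0).continuousAt.tendsto
  have hderiv : deriv (F ∘ ℓ) =ᶠ[𝓝 0] fun t ↦ fderiv ℝ F (ℓ t) v := by
    filter_upwards [hlim.eventually hF] with t ht
    exact (ht.hasFDerivAt.comp_hasDerivAt t (hℓ t)).deriv
  have hderiv' : HasDerivAt (fun t ↦ fderiv ℝ F (ℓ t) v) (fderiv ℝ (fderiv ℝ F) x v v) 0 := by
    simpa using (hF'.hasFDerivAt.comp_hasDerivAt_of_eq 0 (hℓ 0) hℓ0.symm).clm_apply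
      (hasDerivAt_const 0 v)
  have hcont : ContinuousAt (F ∘ ℓ) 0 :=
    ContinuousAt.comp_of_eq hF.self_of_nhds.continuousAt (hℓ 0).continuousAt hℓ0
  have hmin' : IsLocalMin (F ∘ ℓ) 0 := by
    filter_upwards [hlim.eventually hmin] with t ht
    simpa only [Function.comp_apply, hℓ0] using ht
  rw [← hderiv'.deriv, ← hderiv.deriv_eq]
  exact deriv_deriv_nonneg_of_isLocalMin hcont hmin'

theorem isLocalMin_of_fderiv_apply_sub_nonneg {F : V → ℝ} {x : V}
    (hF : ∀ᶠ u in 𝓝 x, DifferentiableAt ℝ F u)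
    (hnonneg : ∀ᶠ u in 𝓝 x, 0 ≤ fderiv ℝ F u (u - x)) : IsLocalMin F x := by
  obtain ⟨ε, hε, hball⟩ := Metric.eventually_nhds_iff_ball.1 (hF.and hnonneg)
  filter_upwards [Metric.ball_mem_nhds x hε] with u hu
  let ℓ : ℝ → V := AffineMap.lineMap x u
  have hmem {t : ℝ} (ht : t ∈ Icc 0 1) : ℓ t ∈ Metric.ball x ε :=
    (convex_ball x ε).lineMap_mem (Metric.mem_ball_self hε) hu ht
  have hderiv {t : ℝ} (ht : t ∈ Icc 0 1) : HasDerivAt (F ∘ ℓ) (fderiv ℝ F (ℓ t) (u - x)) t :=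
    (hball _ (hmem ht)).1.hasFDerivAt.comp_hasDerivAt t AffineMap.hasDerivAt_lineMap
  have hderiv_nonneg {t : ℝ} (ht : t ∈ Ioo 0 1) : 0 ≤ fderiv ℝ F (ℓ t) (u - x) := by
    have h := (hball _ (hmem (Ioo_subset_Icc_self ht))).2
    have hsub : ℓ t - x = t • (u - x) := by simp [ℓ, AffineMap.lineMap_apply]
    rw [hsub, map_smul, smul_eq_mul] at h
    exact nonneg_of_mul_nonneg_right h ht.1
  have hmono : MonotoneOn (F ∘ ℓ) (Icc 0 1) := by
    refine monotoneOn_of_hasDerivWithinAt_nonneg (convex_Icc 0 1)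
      (fun t ht ↦ (hderiv ht).continuousAt.continuousWithinAt)
      (fun t ht ↦ (hderiv (interior_subset ht)).hasDerivWithinAt) fun t ht ↦ ?_
    exact hderiv_nonneg (by rwa [interior_Icc] at ht)
  simpa [ℓ] using hmono (left_mem_Icc.2 zero_le_one) (right_mem_Icc.2 zero_le_one) zero_le_one

theorem eventually_apply_sub_nonneg_of_isCoercive {G : V → V →L[ℝ] ℝ} {G' : V →L[ℝ] V →L[ℝ] ℝ}
    {x : V} (hG : HasFDerivAt G G' x) (h0 : G x = 0) (hG' : IsCoercive G') :
    ∀ᶠ u in 𝓝 x, 0 ≤ G u (u - x) := by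
  obtain ⟨c, hc, hcoercive⟩ := hG'
  filter_upwards [hG.isLittleO.def hc] with u hu
  rw [h0, sub_zero] at hu
  have hremainder : |G u (u - x) - G' (u - x) (u - x)| ≤ c * ‖u - x‖ * ‖u - x‖ :=
    (G u - G' (u - x)).le_of_opNorm_le hu (u - x)
  linarith [hcoercive (u - x), neg_le_of_abs_le hremainder]

theorem isLocalMin_of_isCoercive_fderiv_fderiv {F : V → ℝ} {x : V}
    (hF : ∀ᶠ u in 𝓝 x, DifferentiableAt ℝ F u) (hF' : DifferentiableAt ℝ (fderiv ℝ F) x)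
    (h0 : fderiv ℝ F x = 0) (hcoercive : IsCoercive (fderiv ℝ (fderiv ℝ F) x)) :
    IsLocalMin F x :=
  isLocalMin_of_fderiv_apply_sub_nonneg hF
    (eventually_apply_sub_nonneg_of_isCoercive hF'.hasFDerivAt h0 hcoercive)

theorem isCoercive_bilinearComp {B : W →L[ℝ] W →L[ℝ] ℝ} (hB : IsCoercive B) (e : V ≃L[ℝ] W) :
    IsCoercive (B.bilinearComp (e : V →L[ℝ] W) (e : V →L[ℝ] W)) := by
  obtain ⟨c, hc, hcoercive⟩ := hB
  set K : ℝ := ‖(e.symm : W →L[ℝ] V)‖ + 1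
  have hK : 0 < K := by positivity
  refine ⟨c / K ^ 2, by positivity, fun v ↦ ?_⟩
  have hv : ‖v‖ ≤ K * ‖e v‖ := by
    simpa using (e.symm : W →L[ℝ] V).le_of_opNorm_le (le_add_of_nonneg_right zero_le_one) (e v)
  calc c / K ^ 2 * ‖v‖ * ‖v‖ ≤ c / K ^ 2 * (K * ‖e v‖) * (K * ‖e v‖) := by gcongr
    _ = c * ‖e v‖ * ‖e v‖ := by field_simp
    _ ≤ B (e v) (e v) := hcoercive (e v)

/-- Unlike in the product rule, continuity of `B` suffices, because `Y` vanishes at `x`. -/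
theorem hasFDerivAt_clm_apply_of_eq_zero {E : Type*} [NormedAddCommGroup E] [NormedSpace ℝ E]
    {B : E → V →L[ℝ] W} {Y : E → V} {Y' : E →L[ℝ] V} {x : E}
    (hB : ContinuousAt B x) (hY : HasFDerivAt Y Y' x) (h0 : Y x = 0) :
    HasFDerivAt (fun u ↦ B u (Y u)) ((B x).comp Y') x := by
  have hvar : HasFDerivAt (fun u ↦ (B u - B x) (Y u)) (0 : E →L[ℝ] W) x := by
    refine .of_isLittleO ?_
    have hB0 : (fun u ↦ B u - B x) =o[𝓝 x] fun _ ↦ (1 : ℝ) :=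
      (Asymptotics.isLittleO_one_iff ℝ).2 (tendsto_sub_nhds_zero_iff.2 hB)
    have hY0 : Y =O[𝓝 x] fun u ↦ u - x := by simpa only [h0, sub_zero] using hY.isBigO_sub
    have hprod : (fun u ↦ ‖B u - B x‖ * ‖Y u‖) =o[𝓝 x] fun u ↦ u - x := by
      simpa using (hB0.norm_left.mul_isBigO hY0.norm_norm)
    have hle : (fun u ↦ (B u - B x) (Y u)) =O[𝓝 x] fun u ↦ ‖B u - B x‖ * ‖Y u‖ :=
      .of_norm_le fun u ↦ (B u - B x).le_opNorm (Y u)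
    simpa [h0] using hle.trans_isLittleO hprod
  simpa [Function.comp_def] using hvar.fun_add ((B x).hasFDerivAt.comp x hY)

theorem koszulForm_zero (g : V → V →L[ℝ] V →L[ℝ] ℝ) (u : V) : koszulForm g u 0 = 0 := by
  ext v z
  rw [koszulForm_apply]
  simp only [ContinuousLinearMap.map_zero, zero_apply, add_zero, sub_zero, mul_zero]

end NormedSpace

theorem isLocalMin_comp_symm_iff {X Y β : Type*} [TopologicalSpace X] [TopologicalSpace Y]
    [Preorder β] (e : OpenPartialHomeomorph X Y) {f : X → β} {x : X} (hx : x ∈ e.source) :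
    IsLocalMin (f ∘ e.symm) (e x) ↔ IsLocalMin f x := by
  simp only [IsLocalMin, IsMinFilter, Function.comp_apply, e.left_inv hx]
  exact e.eventually_nhds' (f x ≤ f ·) hx

theorem isContinuousRiemannianBundle_of_isContMDiffRiemannianBundle
    {EB : Type*} [NormedAddCommGroup EB] [NormedSpace ℝ EB] {HB : Type*} [TopologicalSpace HB]
    (IB : ModelWithCorners ℝ EB HB) (n : ℕ∞ω) {B : Type*} [TopologicalSpace B] [ChartedSpace HB B]
    (F : Type*) [NormedAddCommGroup F] [NormedSpace ℝ F] (V : B → Type*)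
    [TopologicalSpace (TotalSpace F V)] [∀ x, NormedAddCommGroup (V x)]
    [∀ x, InnerProductSpace ℝ (V x)] [FiberBundle F V] [VectorBundle ℝ F V]
    [IsContMDiffRiemannianBundle IB n F V] : IsContinuousRiemannianBundle F V := by
  obtain ⟨g, hg, hinner⟩ := IsContMDiffRiemannianBundle.exists_contMDiff
    (IB := IB) (n := n) (F := F) (E := V)
  exact ⟨g, hg.continuous, hinner⟩

section Manifold

variable {E : Type*} [NormedAddCommGroup E] [NormedSpace ℝ E]
  {N : Type*} [TopologicalSpace N] [ChartedSpace E N] [IsManifold 𝓘(ℝ, E) ∞ N]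

theorem coordInv_coord {p y : N} (hy : y ∈ (chartAt E p).source) (v : TangentSpace 𝓘(ℝ, E) y) :
    coordInv p y (coord p y v) = v :=
  (trivializationAt E (TangentSpace 𝓘(ℝ, E)) p).symmL_continuousLinearMapAt (R := ℝ) hy v

theorem hasMFDerivAt_extChartAt_symm {p y : N} (hy : y ∈ (chartAt E p).source) :
    HasMFDerivAt 𝓘(ℝ, E) 𝓘(ℝ, E) (extChartAt 𝓘(ℝ, E) p).symm (extChartAt 𝓘(ℝ, E) p y)
      (coordInv p y : E →L[ℝ] TangentSpace 𝓘(ℝ, E) y) := by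
  have hmem : extChartAt 𝓘(ℝ, E) p y ∈ (extChartAt 𝓘(ℝ, E) p).target :=
    (extChartAt 𝓘(ℝ, E) p).map_source (by rwa [extChartAt_source])
  have hsymm : MDifferentiableAt 𝓘(ℝ, E) 𝓘(ℝ, E) (extChartAt 𝓘(ℝ, E) p).symm
      (extChartAt 𝓘(ℝ, E) p y) := by
    simpa only [modelWithCornersSelf_coe, range_id, mdifferentiableWithinAt_univ] using
      mdifferentiableWithinAt_extChartAt_symm (I := 𝓘(ℝ, E)) hmem
  have hcoordInv : coordInv (E := E) p y =
      mfderiv 𝓘(ℝ, E) 𝓘(ℝ, E) (extChartAt 𝓘(ℝ, E) p).symm (extChartAt 𝓘(ℝ, E) p y) := by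
    have h := TangentBundle.symmL_trivializationAt (I := 𝓘(ℝ, E)) hy
    simp only [modelWithCornersSelf_coe, range_id, mfderivWithin_univ] at h
    exact h
  exact hcoordInv ▸ hsymm.hasMFDerivAt

theorem hasFDerivAt_comp_chart_symm {F : Type*} [NormedAddCommGroup F] [NormedSpace ℝ F]
    {f : N → F} {p y : N} (hy : y ∈ (chartAt E p).source)
    (hf : MDifferentiableAt 𝓘(ℝ, E) 𝓘(ℝ, F) f y) :
    HasFDerivAt (f ∘ (chartAt E p).symm) ((mvfderiv 𝓘(ℝ, E) f y).comp (coordInv p y))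
      (chartAt E p y) := by
  have hf' : HasMFDerivAt 𝓘(ℝ, E) 𝓘(ℝ, F) f ((chartAt E p).symm (chartAt E p y))
      (mvfderiv 𝓘(ℝ, E) f y : TangentSpace 𝓘(ℝ, E) y →L[ℝ] F) := by
    rw [(chartAt E p).left_inv hy]
    exact hf.hasMFDerivAt
  exact (hf'.comp _ (hasMFDerivAt_extChartAt_symm hy)).hasFDerivAt

/-- The coordinates of the vector field `Y` in the preferred chart around `p`, as a function on the
manifold. -/
noncomputable def coordField (p : N) (Y : ∀ y : N, TangentSpace 𝓘(ℝ, E) y) (y : N) : E :=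
  coord p y (Y y)

theorem mdifferentiableAt_coordField {p : N} {Y : ∀ y : N, TangentSpace 𝓘(ℝ, E) y}
    (hY : MDifferentiableAt 𝓘(ℝ, E) (𝓘(ℝ, E).prod 𝓘(ℝ, E))
      (fun y ↦ (⟨y, Y y⟩ : TangentBundle 𝓘(ℝ, E) N)) p) :
    MDifferentiableAt 𝓘(ℝ, E) 𝓘(ℝ, E) (coordField p Y) p := by
  refine ((mdifferentiableAt_totalSpace _ _).1 hY).2.congr_of_eventuallyEq ?_
  filter_upwards [(chartAt E p).open_source.mem_nhds (mem_chart_source E p)] with y hy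
  exact Trivialization.continuousLinearMapAt_apply_of_mem ℝ _ hy _

variable [RiemannianBundle (fun x : N ↦ TangentSpace 𝓘(ℝ, E) x)]

theorem metricInChart_chart_apply {p y : N} (hy : y ∈ (chartAt E p).source) (v w : E) :
    metricInChart p (chartAt E p y) v w =
      inner ℝ (coordInv (E := E) p y v) (coordInv (E := E) p y w) := by
  simp only [metricInChart, bilinearComp_apply]
  rw [(chartAt E p).left_inv hy]
  exact innerSL_apply_apply ℝ _ _

theorem continuousAt_metricInChart
    [IsContinuousRiemannianBundle E (fun x : N ↦ TangentSpace 𝓘(ℝ, E) x)] (p : N) :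
    ContinuousAt (metricInChart (E := E) p) (chartAt E p p) := by
  obtain ⟨g, hgcont, hg⟩ := IsContinuousRiemannianBundle.exists_continuous
    (F := E) (E := fun x : N ↦ TangentSpace 𝓘(ℝ, E) x)
  have hgcoord := hgcont.continuousAt (x := p)
  rw [continuousAt_hom_bundle] at hgcoord
  have hsymm := (chartAt E p).continuousAt_symm (mem_chart_target E p)
  refine (hgcoord.2.comp_of_eq hsymm ((chartAt E p).left_inv (mem_chart_source E p))).congr ?_
  filter_upwards [(chartAt E p).open_target.mem_nhds (mem_chart_target E p)] with u hu
  obtain ⟨y, hy, rfl⟩ := (chartAt E p).surjOn hu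
  ext v w
  rw [metricInChart_chart_apply hy, Function.comp_apply, (chartAt E p).left_inv hy,
    inCoordinates_apply_eq₂ hy hy (mem_univ _), hg]
  have hcoordInv (a : E) :
      coordInv p y a = (trivializationAt E (TangentSpace 𝓘(ℝ, E)) p).symm y a :=
    Trivialization.symmL_apply _ hy a
  rw [hcoordInv, hcoordInv]
  simp

theorem isCoercive_bilinearComp_coordInv {p y : N} (hy : y ∈ (chartAt E p).source)
    {B : TangentSpace 𝓘(ℝ, E) y →L[ℝ] TangentSpace 𝓘(ℝ, E) y →L[ℝ] ℝ}
    (hB : IsCoercive (E := TangentSpace 𝓘(ℝ, E) y) B) :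
    IsCoercive (E := E) (B.bilinearComp (coordInv p y) (coordInv p y)) := by
  let e : E ≃L[ℝ] TangentSpace 𝓘(ℝ, E) y :=
    ((trivializationAt E (TangentSpace 𝓘(ℝ, E)) p).continuousLinearEquivAt ℝ y hy).symm
  have he : (e : E →L[ℝ] TangentSpace 𝓘(ℝ, E) y) = coordInv p y :=
    Trivialization.symm_continuousLinearEquivAt_eq' _ hy
  exact he ▸ isCoercive_bilinearComp hB e

variable [CompleteSpace E]

theorem inner_grad (f : N → ℝ) (x : N) (w : TangentSpace 𝓘(ℝ, E) x) :
    inner ℝ (grad f x) w = mvfderiv 𝓘(ℝ, E) f x w :=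
  haveI := completeSpace_tangentSpace (E := E) x
  InnerProductSpace.toDual_symm_apply

theorem hasFDerivAt_comp_chart_symm_metricInChart {f : N → ℝ} {p y : N}
    (hy : y ∈ (chartAt E p).source) (hf : MDifferentiableAt 𝓘(ℝ, E) 𝓘(ℝ, ℝ) f y) :
    HasFDerivAt (f ∘ (chartAt E p).symm)
      (metricInChart p (chartAt E p y) (coordField p (grad f) y)) (chartAt E p y) := by
  refine (hasFDerivAt_comp_chart_symm hy hf).congr_fderiv ?_
  ext w
  rw [metricInChart_chart_apply hy, coordField, coordInv_coord hy, inner_grad]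
  rfl

theorem fderiv_comp_chart_symm_eq_zero_iff {f : N → ℝ} {p : N}
    (hf : MDifferentiableAt 𝓘(ℝ, E) 𝓘(ℝ, ℝ) f p) :
    fderiv ℝ (f ∘ (chartAt E p).symm) (chartAt E p p) = 0 ↔ grad (E := E) f p = 0 := by
  have hp := mem_chart_source E p
  rw [(hasFDerivAt_comp_chart_symm_metricInChart hp hf).fderiv]
  refine ⟨fun h ↦ ?_, fun h ↦ by simp only [coordField, h, map_zero]⟩
  have h' := DFunLike.congr_fun h (coordField p (grad f) p)
  rw [metricInChart_chart_apply hp, coordField, coordInv_coord hp] at h'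
  exact inner_self_eq_zero.1 h'

theorem eventually_hasFDerivAt_comp_chart_symm {f : N → ℝ} {p : N}
    (hf : ∀ᶠ y in 𝓝 p, MDifferentiableAt 𝓘(ℝ, E) 𝓘(ℝ, ℝ) f y) :
    ∀ᶠ u in 𝓝 (chartAt E p p), HasFDerivAt (f ∘ (chartAt E p).symm)
      (metricInChart p u ((coordField p (grad f) ∘ (chartAt E p).symm) u)) u := by
  have hp := mem_chart_source E p
  refine ((chartAt E p).eventually_nhds _ hp).2 ?_
  filter_upwards [hf, (chartAt E p).open_source.mem_nhds hp] with y hfy hy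
  rw [Function.comp_apply, (chartAt E p).left_inv hy]
  exact hasFDerivAt_comp_chart_symm_metricInChart hy hfy

theorem christoffel_zero (p : N) : christoffel (E := E) p 0 = 0 := by
  have := completeSpace_tangentSpace (E := E) p
  ext v
  refine ext_inner_right ℝ fun w ↦ ?_
  have h : koszulForm (metricInChart (E := E) p) (chartAt E p p) 0 v w = 0 := by
    rw [koszulForm_zero]
    rfl
  rw [zero_apply, inner_zero_left]
  exact (InnerProductSpace.continuousLinearMapOfBilin_apply _ v w).trans h

theorem covDeriv_of_apply_eq_zero {Y : ∀ y : N, TangentSpace 𝓘(ℝ, E) y} {p : N} (h0 : Y p = 0) :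
    covDeriv Y p = (coordInv p p).comp (mvfderiv 𝓘(ℝ, E) (coordField p Y) p) := by
  simp only [covDeriv, h0, christoffel_zero, add_zero]
  rfl

/-- The Hessian as a bilinear form `(v, w) ↦ ⟪Hess f(x)[v], w⟫` on the tangent space. -/
noncomputable def hessForm (f : N → ℝ) (x : N) :
    TangentSpace 𝓘(ℝ, E) x →L[ℝ] TangentSpace 𝓘(ℝ, E) x →L[ℝ] ℝ :=
  (innerSL ℝ : TangentSpace 𝓘(ℝ, E) x →L[ℝ] TangentSpace 𝓘(ℝ, E) x →L[ℝ] ℝ).comp (hess f x)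

theorem hessForm_apply (f : N → ℝ) (x : N) (v w : TangentSpace 𝓘(ℝ, E) x) :
    hessForm f x v w = inner ℝ (hess f x v) w :=
  rfl

theorem hasFDerivAt_fderiv_comp_chart_symm
    [IsContinuousRiemannianBundle E (fun x : N ↦ TangentSpace 𝓘(ℝ, E) x)]
    {f : N → ℝ} {p : N} (hf : ∀ᶠ y in 𝓝 p, MDifferentiableAt 𝓘(ℝ, E) 𝓘(ℝ, ℝ) f y)
    (hgrad : MDifferentiableAt 𝓘(ℝ, E) (𝓘(ℝ, E).prod 𝓘(ℝ, E))
      (fun y ↦ (⟨y, grad f y⟩ : TangentBundle 𝓘(ℝ, E) N)) p)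
    (h0 : grad (E := E) f p = 0) :
    HasFDerivAt (fderiv ℝ (f ∘ (chartAt E p).symm))
      ((hessForm (E := E) f p).bilinearComp (coordInv p p) (coordInv p p)) (chartAt E p p) := by
  have hp := mem_chart_source E p
  have hY := hasFDerivAt_comp_chart_symm hp (mdifferentiableAt_coordField hgrad)
  have hY0 : (coordField p (grad (E := E) f) ∘ (chartAt E p).symm) (chartAt E p p) = 0 := by
    rw [Function.comp_apply, (chartAt E p).left_inv hp, coordField, h0, map_zero]
  have hderiv := hasFDerivAt_clm_apply_of_eq_zero (continuousAt_metricInChart p) hY hY0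
  have hfderiv := (eventually_hasFDerivAt_comp_chart_symm hf).mono fun _ h ↦ h.fderiv
  refine (hderiv.congr_of_eventuallyEq hfderiv).congr_fderiv ?_
  ext v w
  simp only [bilinearComp_apply, comp_apply, metricInChart_chart_apply hp, hessForm_apply, hess,
    covDeriv_of_apply_eq_zero h0]

theorem hessForm_apply_self_nonneg_of_isLocalMin
    [IsContinuousRiemannianBundle E (fun x : N ↦ TangentSpace 𝓘(ℝ, E) x)]
    {f : N → ℝ} {p : N} (hf : ∀ᶠ y in 𝓝 p, MDifferentiableAt 𝓘(ℝ, E) 𝓘(ℝ, ℝ) f y)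
    (hgrad : MDifferentiableAt 𝓘(ℝ, E) (𝓘(ℝ, E).prod 𝓘(ℝ, E))
      (fun y ↦ (⟨y, grad f y⟩ : TangentBundle 𝓘(ℝ, E) N)) p)
    (hmin : IsLocalMin f p) (v : TangentSpace 𝓘(ℝ, E) p) : 0 ≤ hessForm f p v v := by
  have hmin' := (isLocalMin_comp_symm_iff (chartAt E p) (mem_chart_source E p)).2 hmin
  have h0 := (fderiv_comp_chart_symm_eq_zero_iff hf.self_of_nhds).1 hmin'.fderiv_eq_zero
  have hderiv := hasFDerivAt_fderiv_comp_chart_symm hf hgrad h0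
  have hdiff := (eventually_hasFDerivAt_comp_chart_symm hf).mono fun _ h ↦ h.differentiableAt
  have hnonneg := fderiv_fderiv_apply_self_nonneg_of_isLocalMin hdiff
    hderiv.differentiableAt hmin' (coord p p v)
  rw [hderiv.fderiv, bilinearComp_apply, coordInv_coord (mem_chart_source E p)] at hnonneg
  exact hnonneg

theorem isLocalMin_of_isCoercive_hessForm
    [IsContinuousRiemannianBundle E (fun x : N ↦ TangentSpace 𝓘(ℝ, E) x)]
    {f : N → ℝ} {p : N} (hf : ∀ᶠ y in 𝓝 p, MDifferentiableAt 𝓘(ℝ, E) 𝓘(ℝ, ℝ) f y)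
    (hgrad : MDifferentiableAt 𝓘(ℝ, E) (𝓘(ℝ, E).prod 𝓘(ℝ, E))
      (fun y ↦ (⟨y, grad f y⟩ : TangentBundle 𝓘(ℝ, E) N)) p)
    (h0 : grad (E := E) f p = 0)
    (hcoercive : IsCoercive (E := TangentSpace 𝓘(ℝ, E) p) (hessForm f p)) : IsLocalMin f p := by
  have hderiv := hasFDerivAt_fderiv_comp_chart_symm hf hgrad h0
  have hdiff := (eventually_hasFDerivAt_comp_chart_symm hf).mono fun _ h ↦ h.differentiableAt
  rw [← isLocalMin_comp_symm_iff (chartAt E p) (mem_chart_source E p)]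
  refine isLocalMin_of_isCoercive_fderiv_fderiv hdiff hderiv.differentiableAt
    ((fderiv_comp_chart_symm_eq_zero_iff hf.self_of_nhds).2 h0) ?_
  rw [hderiv.fderiv]
  exact isCoercive_bilinearComp_coordInv (mem_chart_source E p) hcoercive

end Manifold

end RiemannianOpt

theorem theorem2p5_general
    {E : Type*} [NormedAddCommGroup E] [NormedSpace ℝ E] [CompleteSpace E]
    {N : Type*} [TopologicalSpace N] [ChartedSpace E N] [IsManifold 𝓘(ℝ, E) ∞ N]
    [RiemannianBundle (fun x : N ↦ TangentSpace 𝓘(ℝ, E) x)]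
    [IsContMDiffRiemannianBundle 𝓘(ℝ, E) 1 E (fun x : N ↦ TangentSpace 𝓘(ℝ, E) x)]
    {f : N → ℝ} {x : N} (hf : ∀ᶠ y in 𝓝 x, MDifferentiableAt 𝓘(ℝ, E) 𝓘(ℝ, ℝ) f y)
    (hgrad : MDifferentiableAt 𝓘(ℝ, E) (𝓘(ℝ, E).prod 𝓘(ℝ, E))
      (fun y ↦ (⟨y, RiemannianOpt.grad f y⟩ : TangentBundle 𝓘(ℝ, E) N)) x) :
    (IsLocalMin f x →
      ∀ h : TangentSpace 𝓘(ℝ, E) x, 0 ≤ inner ℝ (RiemannianOpt.hess f x h) h) ∧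
    (RiemannianOpt.grad (E := E) f x = 0 →
      (∃ c > 0, ∀ h : TangentSpace 𝓘(ℝ, E) x,
        c * ‖h‖ ^ 2 ≤ inner ℝ (RiemannianOpt.hess f x h) h) →
      IsLocalMin f x) := by
  have := RiemannianOpt.isContinuousRiemannianBundle_of_isContMDiffRiemannianBundle 𝓘(ℝ, E) 1 E
    (fun x : N ↦ TangentSpace 𝓘(ℝ, E) x)
  refine ⟨RiemannianOpt.hessForm_apply_self_nonneg_of_isLocalMin hf hgrad, fun h0 ⟨c, hc, hle⟩ ↦
    RiemannianOpt.isLocalMin_of_isCoercive_hessForm hf hgrad h0 ⟨c, hc, fun h ↦ ?_⟩⟩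
  simpa only [RiemannianOpt.hessForm_apply, mul_assoc, sq] using hle h

theorem theorem2p5
    {E : Type*} [NormedAddCommGroup E] [NormedSpace ℝ E] [CompleteSpace E]
    {N : Type*} [TopologicalSpace N] [T2Space N] [ChartedSpace E N] [IsManifold 𝓘(ℝ, E) ∞ N]
    [RiemannianBundle (fun x : N ↦ TangentSpace 𝓘(ℝ, E) x)]
    [IsContMDiffRiemannianBundle 𝓘(ℝ, E) ∞ E (fun x : N ↦ TangentSpace 𝓘(ℝ, E) x)]
    (U : Set N) (hUopen : IsOpen U) (hUconv : RiemannianOpt.GeodesicallyConvex E U)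
    (f : N → ℝ) (hf : RiemannianOpt.TwiceDifferentiableOn (E := E) f U)
    (xhat : N) (hxhat : xhat ∈ U) :
    (IsLocalMinOn f U xhat →
      ∀ h : TangentSpace 𝓘(ℝ, E) xhat, 0 ≤ inner ℝ (RiemannianOpt.hess f xhat h) h) ∧
    (RiemannianOpt.grad (E := E) f xhat = 0 →
      (∃ c > 0, ∀ h : TangentSpace 𝓘(ℝ, E) xhat,
        c * ‖h‖ ^ 2 ≤ inner ℝ (RiemannianOpt.hess f xhat h) h) →
      (∃ L : ℝ, RiemannianOpt.HessLipschitzAt (E := E) f U L xhat) →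
      IsLocalMinOn f U xhat) := by
  have hU := hUopen.mem_nhds hxhat
  obtain ⟨necessary, sufficient⟩ := theorem2p5_general
    (Filter.mem_of_superset hU fun y hy ↦ (hf y hy).1) (hf xhat hxhat).2
  exact ⟨fun hmin ↦ necessary (hmin.isLocalMin hU), fun h0 hc _ ↦ (sufficient h0 hc).on U⟩
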